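/- Theorem. Let $G$ be a locally compact group acting continuously and properly on a non-empty locally compact space $S$, let $m$ be a $G$-invariant Borel measure on $S$, and let $X$ be another locally compact space with a continuous action of $G$; here $G$, $S$ and $X$ are assumed to be second countable and Hausdorff. Let $P$ be a Markov operator on $S$, $Pf(s)=\int f\,d\pi_s$, which is $G$-invariant, i.e. $\pi_{gs}=g\pi_s$ for all $g\in G$, $s\in S$, and whose transition probabilities $\pi_s$ are absolutely continuous with continuous densities with respect to $m$, i.e. $d\pi_s(t)=p(s,t)\,dm(t)$ for a continuous function $p:S\times S\to[0,\infty)$. A Borel function $f:S\to\mathbb R$ is called $P$-harmonic if $f$ is $\pi_s$-integrable and $\int f\,d\pi_s=f(s)$ for every $s\in S$; a harmonic function $\varphi$ with $\varphi(s)>0$ for all $s$ is called minimal if every $P$-harmonic function $\psi$ with $0\le\psi\le\varphi$ is a constant multiple of $\varphi$. The projective class $[\varphi]$ of a positive function $\varphi$ is the set of its positive constant multiples; the set of projective classes carries the quotient of the topology of pointwise convergence on positive functions on $S$, and $G$ acts on it by $g[\varphi]=[\varphi(g^{-1}\,\cdot)]$. Suppose that there is a continuous $G$-equivariant map assigning to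 each $x\in X$ the projective class $[\varphi_x]$ of a minimal positive $P$-harmonic function $\varphi_x$. Then the action of $G$ on $X$ is topologically amenable: there is a sequence of weak$^*$ continuous maps $\theta_n$ from $X$ to the space of Borel probability measures on $G$ such that $$\|g\theta_n(x)-\theta_n(gx)\|\longrightarrow 0\qquad (n\to\infty)$$ uniformly on compact subsets of $G\times X$, where $\|\cdot\|$ is the total variation norm. -/

import Mathlib

open MeasureTheory ProbabilityTheory Filter Topology

noncomputable section

namespace MarkovAmenability

/-! ### Topological amenability of a group action -/

/-- The total variation norm `‖μ - ν‖` of the difference of two finite measures. -/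
def tvNorm {Y : Type*} [MeasurableSpace Y] (μ ν : Measure Y)
    [IsFiniteMeasure μ] [IsFiniteMeasure ν] : ℝ :=
  (μ.toSignedMeasure - ν.toSignedMeasure).totalVariation.real Set.univ

/-- The action of `G` on `X` is topologically amenable: there are weakly continuous maps
`θ n : X → Pr(G)` such that `‖g θ n x - θ n (g x)‖ → 0` uniformly on compact subsets of `G × X`,
where `g` acts on measures on `G` by left translation. The topology on `ProbabilityMeasure G` is
that of weak convergence; on a locally compact second countable Hausdorff group it agrees, for
probability measures, with the weak-star topology given by `C_c(G)`. -/
def TopologicallyAmenable (G X : Type*) [Group G] [TopologicalSpace G] [IsTopologicalGroup G]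
    [MeasurableSpace G] [BorelSpace G] [TopologicalSpace X] [MulAction G X] : Prop :=
  ∃ θ : ℕ → X → ProbabilityMeasure G,
    (∀ n, Continuous (θ n)) ∧
    ∀ K : Set (G × X), IsCompact K →
      TendstoUniformlyOn
        (fun (n : ℕ) (z : G × X) =>
          tvNorm ((θ n z.2 : Measure G).map (fun h => z.1 * h)) (θ n (z.1 • z.2) : Measure G))
        (fun _ => 0) atTop K

/-! ### Invariant Markov operators, given by their transition probabilities -/

/-- The Markov operator with transition probabilities `π s` is `G`-invariant:
`π (g s) = g (π s)`. -/
def IsInvariantOperator (G : Type*) {S : Type*} [Group G] [MeasurableSpace S] [MulAction G S]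
    (π : Kernel S S) : Prop :=
  ∀ (g : G) (s : S), π (g • s) = (π s).map (fun t => g • t)

/-- The transition probabilities are absolutely continuous with respect to `m`, with a
(jointly) continuous non-negative density `p s t = dπ_s / dm (t)`. -/
def HasContinuousDensities {S : Type*} [TopologicalSpace S] [MeasurableSpace S]
    (π : Kernel S S) (m : Measure S) : Prop :=
  ∃ p : S → S → NNReal, Continuous (Function.uncurry p) ∧
    ∀ s, π s = m.withDensity (fun t => (p s t : ENNReal))

/-! ### Minimal positive harmonic functions -/

/-- A Borel function `f` is harmonic: `P f = f`, the integrals defining `P f` being convergent. -/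
def IsHarmonic {S : Type*} [MeasurableSpace S] (π : Kernel S S) (f : S → ℝ) : Prop :=
  Measurable f ∧ ∀ s, Integrable f (π s) ∧ ∫ t, f t ∂(π s) = f s

/-- A strictly positive harmonic function is minimal if every non-negative harmonic function
dominated by it is proportional to it. -/
def IsMinimalPositiveHarmonic {S : Type*} [MeasurableSpace S] (π : Kernel S S)
    (f : S → ℝ) : Prop :=
  IsHarmonic π f ∧ (∀ s, 0 < f s) ∧
    ∀ h : S → ℝ, IsHarmonic π h → (∀ s, 0 ≤ h s) → (∀ s, h s ≤ f s) →
      ∃ c : ℝ, ∀ s, h s = c * f s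

/-! ### Projective classes of positive functions -/

/-- Strictly positive functions on `S`, with the topology of pointwise convergence. -/
abbrev PosFun (S : Type*) : Type _ := {f : S → ℝ // ∀ s, 0 < f s}

/-- Two positive functions are equivalent if they differ by a positive multiplicative constant. -/
instance projSetoid (S : Type*) : Setoid (PosFun S) where
  r f h := ∃ c : ℝ, 0 < c ∧ ∀ s, h.1 s = c * f.1 s
  iseqv :=
    { refl := fun f => ⟨1, one_pos, fun s => (one_mul _).symm⟩
      symm := by
        rintro f h ⟨c, hc, e⟩
        refine ⟨c⁻¹, inv_pos.mpr hc, fun s => ?_⟩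
        rw [e s, inv_mul_cancel_left₀ hc.ne']
      trans := by
        rintro f h k ⟨c, hc, e⟩ ⟨d, hd, e'⟩
        refine ⟨d * c, mul_pos hd hc, fun s => ?_⟩
        rw [e' s, e s, mul_assoc] }

/-- The space of projective classes of positive functions on `S`; as an abbreviation for a
quotient it carries the quotient topology. -/
abbrev ProjClass (S : Type*) : Type _ := Quotient (projSetoid S)

/-- The translate `(g f)(s) = f (g⁻¹ s)` of a positive function. -/
def PosFun.translate {G S : Type*} [Group G] [MulAction G S] (g : G) (f : PosFun S) : PosFun S :=
  ⟨fun s => f.1 (g⁻¹ • s), fun s => f.2 (g⁻¹ • s)⟩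

/-- The induced action of `G` on projective classes. -/
def ProjClass.translate {G S : Type*} [Group G] [MulAction G S] (g : G) :
    ProjClass S → ProjClass S :=
  Quotient.map (PosFun.translate g) (by
    rintro f h ⟨c, hc, e⟩
    exact ⟨c, hc, fun s => e (g⁻¹ • s)⟩)

/-- A projective class consists of minimal positive harmonic functions (minimality is invariant
under scaling, so it is enough that one representative is minimal). -/
def ProjClass.IsMinimalHarmonic {S : Type*} [MeasurableSpace S] (π : Kernel S S)
    (a : ProjClass S) : Prop :=
  ∃ f : PosFun S, IsMinimalPositiveHarmonic π f.1 ∧ (Quotient.mk (projSetoid S) f) = a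

end MarkovAmenability

end

/-! Normalize `φ_x` at a base point `o` and let `κ_x` be the Doob transform of `π` by `φ_x`, a
Markov kernel with `κ_{gx}(gs) = g κ_x(s)`. Minimality of `φ_x` says that bounded `κ_x`-harmonic
functions are constant (`eq_of_doob_harmonic`). By a zero-two type argument this forces averages of
the chain along its first `2 ^ n` steps to forget the starting point in total variation
(`exists_integral_dyadicMean_sub_le`). Put `θ_n(x) = T A_n(x, o)`, where `A_n(x, s)` is the dyadic
mean of `κ_x` started at `κ_x(s)` and `T` is an equivariant Markov kernel from `S` to `G`, which
exists because the action on `S` is proper. Then `g θ_n(x) = T A_n(gx, go)`, to be compared with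
`θ_n(gx) = T A_n(gx, o)`: same chain, two starting points.

Uniformity on compact sets is a Dini argument. For fixed `(g, x)` the distance between `A_n(gx, go)`
and `A_n(gx, o)` does not increase with `n`, because consecutive dyadic means differ by a Markov
factor; so a bound at a single `n`, extended to a neighbourhood by continuity, persists for all
larger `n`. Continuity in total variation comes from Scheffé's lemma. The delicate point is
continuity of the normalizing factor `φ_{gx}(go)`: Fatou gives only lower semicontinuity of
`φ_x(s)`, but `φ_{gx}(go) φ_x(g⁻¹o) = 1` makes both factors continuous (`tendsto_smul_base`). -/

noncomputable section

namespace MarkovAmenability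

/-! ### Total variation by duality, and Scheffé's lemma -/

/-- Measurable functions with values in `[-1, 1]`. -/
def UnitFun {Y : Type*} [MeasurableSpace Y] (f : Y → ℝ) : Prop :=
  Measurable f ∧ ∀ y, |f y| ≤ 1

theorem UnitFun.integrable {Y : Type*} [MeasurableSpace Y] {f : Y → ℝ} (hf : UnitFun f)
    (μ : Measure Y) [IsFiniteMeasure μ] : Integrable f μ :=
  Integrable.of_bound hf.1.aestronglyMeasurable 1 (ae_of_all _ fun y => hf.2 y)

theorem UnitFun.abs_integral_le {Y : Type*} [MeasurableSpace Y] {f : Y → ℝ} (hf : UnitFun f)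
    (μ : Measure Y) [IsProbabilityMeasure μ] : |∫ y, f y ∂μ| ≤ 1 := by
  have := norm_integral_le_of_norm_le_const (μ := μ) (f := f) (C := 1) (ae_of_all _ fun y => hf.2 y)
  simpa using this

theorem UnitFun.kernel_integral {Y Z : Type*} [MeasurableSpace Y] [MeasurableSpace Z]
    {f : Z → ℝ} (hf : UnitFun f) (κ : Kernel Y Z) [IsMarkovKernel κ] :
    UnitFun (fun y => ∫ z, f z ∂(κ y)) :=
  ⟨hf.1.stronglyMeasurable.integral_kernel.measurable, fun y => hf.abs_integral_le (κ y)⟩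

/-- The total variation norm is bounded by the supremum over functions with values in `[-1, 1]`. -/
theorem tvNorm_le {Y : Type*} [MeasurableSpace Y] (μ ν : Measure Y)
    [IsFiniteMeasure μ] [IsFiniteMeasure ν] {C : ℝ}
    (h : ∀ f : Y → ℝ, UnitFun f → ∫ y, f y ∂μ - ∫ y, f y ∂ν ≤ C) : tvNorm μ ν ≤ C := by
  classical
  set s := μ.toSignedMeasure - ν.toSignedMeasure with hs
  obtain ⟨i, hi, hi₂, hi₃, hpos, hneg⟩ := s.toJordanDecomposition_spec
  have hval : ∀ A, MeasurableSet A → s A = μ.real A - ν.real A := fun A hA => by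
    rw [hs, Measure.toSignedMeasure_sub_apply hA]
  have h1 : tvNorm μ ν = s i - s iᶜ := by
    rw [tvNorm, ← hs, SignedMeasure.totalVariation, measureReal_add_apply, hpos, hneg,
      SignedMeasure.toMeasureOfZeroLE_real_apply _ hi₂ hi MeasurableSet.univ,
      SignedMeasure.toMeasureOfLEZero_real_apply _ hi₃ hi.compl MeasurableSet.univ]
    simp [sub_eq_add_neg]
  -- The sign function of a Hahn decomposition attains the total variation.
  let f : Y → ℝ := fun y => i.indicator (fun _ => (1 : ℝ)) y - iᶜ.indicator (fun _ => (1 : ℝ)) y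
  have hf : UnitFun f := by
    refine ⟨(measurable_const.indicator hi).sub (measurable_const.indicator hi.compl), fun y => ?_⟩
    by_cases hy : y ∈ i <;> simp [f, hy]
  have h2 : ∀ ρ : Measure Y, IsFiniteMeasure ρ → ∫ y, f y ∂ρ = ρ.real i - ρ.real iᶜ := by
    intro ρ _
    rw [integral_sub ((integrable_const _).indicator hi) ((integrable_const _).indicator hi.compl),
      integral_indicator_const _ hi, integral_indicator_const _ hi.compl]
    simp
  have h3 := h f hf
  rw [h2 μ inferInstance, h2 ν inferInstance] at h3
  rw [h1, hval i hi, hval _ hi.compl]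
  linarith

theorem tvNorm_nonneg {Y : Type*} [MeasurableSpace Y] (μ ν : Measure Y)
    [IsFiniteMeasure μ] [IsFiniteMeasure ν] : 0 ≤ tvNorm μ ν :=
  measureReal_nonneg

/-- Convergence in total variation, in dual form. -/
def TVTendsto {ι Y : Type*} [MeasurableSpace Y] (ν : ι → Measure Y) (l : Filter ι)
    (ν₀ : Measure Y) : Prop :=
  ∀ ε > 0, ∀ᶠ i in l, ∀ f : Y → ℝ, UnitFun f → |∫ y, f y ∂(ν i) - ∫ y, f y ∂ν₀| ≤ ε

/-- Truncating by the limit supplies the dominating function, so no convergence of the integrals is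
needed. This serves both Scheffé's lemma and, as a substitute for Fatou, the lower semicontinuity of
the harmonic functions. -/
theorem tendsto_integral_min {ι α : Type*} [MeasurableSpace α] {m : Measure α} {l : Filter ι}
    [l.IsCountablyGenerated] {f : ι → α → ℝ} {f₀ : α → ℝ} (hf : ∀ i, Integrable (f i) m)
    (hf0 : ∀ i a, 0 ≤ f i a) (hf₀ : Integrable f₀ m) (hf₀0 : ∀ a, 0 ≤ f₀ a)
    (hlim : ∀ a, Tendsto (fun i => f i a) l (𝓝 (f₀ a))) :
    Tendsto (fun i => ∫ a, min (f i a) (f₀ a) ∂m) l (𝓝 (∫ a, f₀ a ∂m)) := by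
  refine tendsto_integral_filter_of_dominated_convergence f₀
    (Eventually.of_forall fun i => ((hf i).inf hf₀).aestronglyMeasurable)
    (Eventually.of_forall fun i => ae_of_all _ fun a => ?_) hf₀ (ae_of_all _ fun a => ?_)
  · rw [Real.norm_of_nonneg (le_min (hf0 i a) (hf₀0 a))]
    exact min_le_right _ _
  · simpa using (hlim a).min (tendsto_const_nhds (x := f₀ a))

/-- **Scheffé's lemma**. -/
theorem tendsto_integral_abs_sub {ι α : Type*} [MeasurableSpace α] {m : Measure α} {l : Filter ι}
    [l.IsCountablyGenerated] {f : ι → α → ℝ} {f₀ : α → ℝ} (hf : ∀ i, Integrable (f i) m)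
    (hf0 : ∀ i a, 0 ≤ f i a) (hf₀ : Integrable f₀ m) (hf₀0 : ∀ a, 0 ≤ f₀ a)
    (hlim : ∀ a, Tendsto (fun i => f i a) l (𝓝 (f₀ a)))
    (hint : Tendsto (fun i => ∫ a, f i a ∂m) l (𝓝 (∫ a, f₀ a ∂m))) :
    Tendsto (fun i => ∫ a, |f i a - f₀ a| ∂m) l (𝓝 0) := by
  -- Integrated form of `|a - b| = a + b - 2 min(a, b)`.
  have h1 : ∀ i, ∫ a, |f i a - f₀ a| ∂m =
      ∫ a, f i a ∂m + ∫ a, f₀ a ∂m - 2 * ∫ a, min (f i a) (f₀ a) ∂m := by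
    intro i
    have hmin : Integrable (fun a => min (f i a) (f₀ a)) m := (hf i).inf hf₀
    rw [← integral_const_mul, ← integral_add (hf i) hf₀,
      ← integral_sub (by exact (hf i).add hf₀) (hmin.const_mul 2)]
    refine integral_congr_ae (ae_of_all _ fun a => ?_)
    simp only
    rcases le_total (f i a) (f₀ a) with h | h
    · rw [min_eq_left h, abs_of_nonpos (by linarith)]; ring
    · rw [min_eq_right h, abs_of_nonneg (by linarith)]; ring
  simp_rw [h1]
  have := (hint.add_const (∫ a, f₀ a ∂m)).sub
    ((tendsto_integral_min hf hf0 hf₀ hf₀0 hlim).const_mul 2)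
  convert this using 2
  ring

theorem abs_integral_mul_sub_le {α : Type*} [MeasurableSpace α] {m : Measure α}
    {h f f₀ : α → ℝ} (hh : UnitFun h) (hf : Integrable f m) (hf₀ : Integrable f₀ m) :
    |∫ a, f a * h a ∂m - ∫ a, f₀ a * h a ∂m| ≤ ∫ a, |f a - f₀ a| ∂m := by
  have hb : ∀ᵐ a ∂m, ‖h a‖ ≤ 1 := ae_of_all _ hh.2
  rw [← integral_sub (hf.mul_bdd hh.1.aestronglyMeasurable hb)
    (hf₀.mul_bdd hh.1.aestronglyMeasurable hb)]
  refine (abs_integral_le_integral_abs).trans (integral_mono_of_nonneg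
    (ae_of_all _ fun a => abs_nonneg _) (hf.sub hf₀).abs (ae_of_all _ fun a => ?_))
  simp only [← sub_mul, abs_mul]
  exact mul_le_of_le_one_right (abs_nonneg _) (hh.2 a)

/-! ### Almost everywhere convergent sequences in decreasing convex sets -/

/-- Choose nearly norm-minimal vectors. The minimal norms increase to a finite limit and midpoints
stay in the convex sets, so the parallelogram law forces the choices together. -/
theorem exists_cauchySeq_of_antitone_convex {E : Type*} [NormedAddCommGroup E]
    [InnerProductSpace ℝ E] (D : ℕ → Set E) (hanti : Antitone D) (hconv : ∀ n, Convex ℝ (D n))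
    (hne : ∀ n, (D n).Nonempty) {R : ℝ} (hR : ∀ v ∈ D 0, ‖v‖ ≤ R) :
    ∃ v : ℕ → E, (∀ n, v n ∈ D n) ∧ CauchySeq v := by
  set d : ℕ → ℝ := fun n => sInf (norm '' D n) with hd
  have hbdd : ∀ n, BddBelow (norm '' D n) := fun n =>
    ⟨0, by rintro _ ⟨v, -, rfl⟩; exact norm_nonneg v⟩
  have hdle : ∀ n, ∀ v ∈ D n, d n ≤ ‖v‖ := fun n v hv => csInf_le (hbdd n) ⟨v, hv, rfl⟩
  have hd0 : ∀ n, 0 ≤ d n := fun n => le_csInf ((hne n).image _)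
    (by rintro _ ⟨v, -, rfl⟩; exact norm_nonneg v)
  have hmono : Monotone d := fun n k hnk =>
    csInf_le_csInf (hbdd n) ((hne k).image _) (Set.image_mono (hanti hnk))
  have hdR : BddAbove (Set.range d) := by
    refine ⟨R, ?_⟩
    rintro _ ⟨n, rfl⟩
    obtain ⟨v, hv⟩ := hne n
    exact (hdle n v hv).trans (hR v (hanti (Nat.zero_le n) hv))
  have hlim := tendsto_atTop_ciSup hmono hdR
  set δ := ⨆ n, d n
  have hex : ∀ n, ∃ v ∈ D n, ‖v‖ < d n + 1 / ((n : ℝ) + 1) := by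
    intro n
    obtain ⟨_, ⟨v, hv, rfl⟩, hlt⟩ := exists_lt_of_csInf_lt ((hne n).image norm)
      (show sInf (norm '' D n) < d n + 1 / ((n : ℝ) + 1) from
        lt_add_of_pos_right _ Nat.one_div_pos_of_nat)
    exact ⟨v, hv, hlt⟩
  choose v hv hvlt using hex
  refine ⟨v, hv, cauchySeq_of_le_tendsto_0
    (fun N => √(4 * (δ + 1 / ((N : ℝ) + 1)) ^ 2 - 4 * d N ^ 2)) (fun n k N hn hk => ?_) ?_⟩
  · have hb : ∀ j, N ≤ j → ‖v j‖ ≤ δ + 1 / ((N : ℝ) + 1) := fun j hj =>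
      (hvlt j).le.trans (add_le_add (le_ciSup hdR j) (Nat.one_div_le_one_div hj))
    have hsum : 2 * d N ≤ ‖v n + v k‖ := by
      have := hdle N _ (convex_iff_add_mem.1 (hconv N) (hanti hn (hv n)) (hanti hk (hv k))
        (by norm_num : (0 : ℝ) ≤ 1 / 2) (by norm_num : (0 : ℝ) ≤ 1 / 2) (by norm_num))
      rw [← smul_add, norm_smul, Real.norm_of_nonneg (by norm_num)] at this
      linarith
    rw [dist_eq_norm]
    refine Real.le_sqrt_of_sq_le ?_
    have hp := parallelogram_law_with_norm ℝ (v n) (v k)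
    have h1 : ‖v n‖ ^ 2 ≤ (δ + 1 / ((N : ℝ) + 1)) ^ 2 :=
      pow_le_pow_left₀ (norm_nonneg _) (hb n hn) 2
    have h2 : ‖v k‖ ^ 2 ≤ (δ + 1 / ((N : ℝ) + 1)) ^ 2 :=
      pow_le_pow_left₀ (norm_nonneg _) (hb k hk) 2
    have h3 : (2 * d N) ^ 2 ≤ ‖v n + v k‖ ^ 2 :=
      pow_le_pow_left₀ (by have := hd0 N; positivity) hsum 2
    nlinarith
  · have h1 : Tendsto (fun N : ℕ => 4 * (δ + 1 / ((N : ℝ) + 1)) ^ 2 - 4 * d N ^ 2) atTop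
        (𝓝 (4 * (δ + 0) ^ 2 - 4 * δ ^ 2)) :=
      ((((tendsto_one_div_add_atTop_nhds_zero_nat (𝕜 := ℝ)).const_add δ).pow 2).const_mul 4).sub
        ((hlim.pow 2).const_mul 4)
    simpa using h1.sqrt

/-- A replacement for weak-star compactness: the Cauchy sequence is found in `L²(μ)`, and an almost
everywhere convergent subsequence still meets the constraints because the sets decrease. -/
theorem exists_ae_tendsto_of_antitone_convex {α : Type*} [MeasurableSpace α] (μ : Measure α)
    [IsFiniteMeasure μ] (C : ℕ → Set (α → ℝ)) (hanti : Antitone C)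
    (hconv : ∀ n, Convex ℝ (C n)) (hne : ∀ n, (C n).Nonempty) (hunit : ∀ f ∈ C 0, UnitFun f) :
    ∃ w : ℕ → α → ℝ, (∀ n, w n ∈ C n) ∧
      ∃ h : α → ℝ, Measurable h ∧ ∀ᵐ a ∂μ, Tendsto (fun n => w n a) atTop (𝓝 (h a)) := by
  have hmem : ∀ n, ∀ f ∈ C n, MemLp f 2 μ := fun n f hf =>
    MemLp.of_bound (hunit f (hanti (Nat.zero_le n) hf)).1.aestronglyMeasurable 1
      (ae_of_all _ (hunit f (hanti (Nat.zero_le n) hf)).2)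
  let D : ℕ → Set (Lp ℝ 2 μ) := fun n => {v | ∃ f ∈ C n, v =ᵐ[μ] f}
  obtain ⟨v, hvD, hv⟩ := exists_cauchySeq_of_antitone_convex D
    (fun n k hnk v ⟨f, hf, hvf⟩ => ⟨f, hanti hnk hf, hvf⟩)
    (fun n v ⟨f, hf, hvf⟩ w ⟨g, hg, hwg⟩ a b ha hb hab => by
      refine ⟨a • f + b • g, hconv n hf hg ha hb hab, ?_⟩
      filter_upwards [Lp.coeFn_add (a • v) (b • w), Lp.coeFn_smul a v, Lp.coeFn_smul b w, hvf,
        hwg] with s h1 h2 h3 h4 h5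
      rw [h1, Pi.add_apply, h2, h3]
      simp [h4, h5])
    (fun n => by
      obtain ⟨f, hf⟩ := hne n
      exact ⟨(hmem n f hf).toLp f, f, hf, MemLp.coeFn_toLp _⟩)
    (R := (measureUnivNNReal μ : ℝ) ^ (ENNReal.toReal 2)⁻¹ * 1) (by
      rintro v ⟨f, hf, hvf⟩
      refine Lp.norm_le_of_ae_bound zero_le_one ?_
      filter_upwards [hvf] with s hs
      rw [hs]
      exact (hunit f hf).2 s)
  obtain ⟨v₀, hv₀⟩ := cauchySeq_tendsto_of_complete hv
  obtain ⟨ns, hns, hae⟩ := (tendstoInMeasure_of_tendsto_Lp hv₀).exists_seq_tendsto_ae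
  choose f hf hvf using hvD
  refine ⟨fun n => f (ns n), fun n => hanti (hns.id_le n) (hf (ns n)),
    (Lp.aestronglyMeasurable v₀).aemeasurable.mk v₀,
    (Lp.aestronglyMeasurable v₀).aemeasurable.measurable_mk, ?_⟩
  filter_upwards [hae, ae_all_iff.2 hvf, (Lp.aestronglyMeasurable v₀).aemeasurable.ae_eq_mk]
    with s h1 h2 h3
  rw [← h3]
  simpa [h2] using h1

section DyadicMeans

/-! ### Markov kernels as operators on bounded measurable functions, and their dyadic means -/

/-- The space of bounded measurable functions. -/
def BddMeas (S : Type*) [MeasurableSpace S] : Submodule ℝ (S → ℝ) where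
  carrier := {f | Measurable f ∧ ∃ C, ∀ s, |f s| ≤ C}
  add_mem' := by
    rintro f g ⟨hf, C, hC⟩ ⟨hg, D, hD⟩
    exact ⟨hf.add hg, C + D, fun s => (abs_add_le _ _).trans (add_le_add (hC s) (hD s))⟩
  zero_mem' := ⟨measurable_const, 0, fun s => by simp⟩
  smul_mem' := by
    rintro c f ⟨hf, C, hC⟩
    refine ⟨hf.const_smul c, |c| * C, fun s => ?_⟩
    rw [Pi.smul_apply, smul_eq_mul, abs_mul]
    exact mul_le_mul_of_nonneg_left (hC s) (abs_nonneg c)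

variable {S : Type*} [MeasurableSpace S]

theorem integrable_bddMeas (f : BddMeas S) (μ : Measure S) [IsFiniteMeasure μ] :
    Integrable f.1 μ :=
  let ⟨C, hC⟩ := f.2.2
  Integrable.of_bound f.2.1.aestronglyMeasurable C (ae_of_all _ fun y => hC y)

/-- The element of `BddMeas S` given by a measurable function with values in `[-1, 1]`. -/
def UnitFun.toBddMeas {f : S → ℝ} (hf : UnitFun f) : BddMeas S := ⟨f, hf.1, 1, hf.2⟩

/-- The operator on bounded measurable functions defined by a Markov kernel. -/
def kernelOp (κ : Kernel S S) [IsMarkovKernel κ] : Module.End ℝ (BddMeas S) where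
  toFun f := ⟨fun s => ∫ t, f.1 t ∂(κ s),
    f.2.1.stronglyMeasurable.integral_kernel.measurable, by
      obtain ⟨C, hC⟩ := f.2.2
      refine ⟨C, fun s => ?_⟩
      have := norm_integral_le_of_norm_le_const (μ := κ s) (f := f.1) (C := C) (ae_of_all _ fun y => hC y)
      simpa using this⟩
  map_add' f g := by
    ext s
    exact integral_add (integrable_bddMeas f _) (integrable_bddMeas g _)
  map_smul' c f := by
    ext s
    exact integral_const_mul c f.1

/-- The average of the first `2 ^ n` powers of the operator of a Markov kernel. -/
def dyadicMeanOp (κ : Kernel S S) [IsMarkovKernel κ] (n : ℕ) : Module.End ℝ (BddMeas S) :=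
  ((2 : ℝ) ^ n)⁻¹ • ∑ i ∈ Finset.range (2 ^ n), kernelOp κ ^ i

section

variable (κ : Kernel S S) [IsMarkovKernel κ]

theorem UnitFun.kernelOp {f : BddMeas S} (hf : UnitFun f.1) : UnitFun (kernelOp κ f).1 :=
  hf.kernel_integral κ

theorem UnitFun.kernelOp_pow {f : BddMeas S} (hf : UnitFun f.1) (i : ℕ) :
    UnitFun ((MarkovAmenability.kernelOp κ ^ i) f).1 := by
  induction i with
  | zero => simpa using hf
  | succ i ih =>
    rw [pow_succ']
    exact UnitFun.kernelOp κ ih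

theorem dyadicMeanOp_apply (n : ℕ) (f : BddMeas S) (s : S) : (dyadicMeanOp κ n f).1 s =
    ((2 : ℝ) ^ n)⁻¹ * ∑ i ∈ Finset.range (2 ^ n), ((kernelOp κ ^ i) f).1 s := by
  simp [dyadicMeanOp, LinearMap.sum_apply]

theorem UnitFun.dyadicMeanOp {f : BddMeas S} (hf : UnitFun f.1) (n : ℕ) :
    UnitFun (dyadicMeanOp κ n f).1 := by
  refine ⟨(MarkovAmenability.dyadicMeanOp κ n f).2.1, fun s => ?_⟩
  rw [dyadicMeanOp_apply, abs_mul, abs_of_pos (by positivity), inv_mul_le_iff₀ (by positivity)]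
  refine (Finset.abs_sum_le_sum_abs _ _).trans
    ((Finset.sum_le_sum fun i _ => (hf.kernelOp_pow κ i).2 s).trans ?_)
  simp

/-- This factorization is the reason for dyadic lengths: the extra factor is again a Markov
operator, which is what makes total variation estimates persist. -/
theorem dyadicMeanOp_succ (n : ℕ) : dyadicMeanOp κ (n + 1) =
    dyadicMeanOp κ n * ((2 : ℝ)⁻¹ • (1 + kernelOp κ ^ 2 ^ n)) := by
  have h : ∑ i ∈ Finset.range (2 ^ (n + 1)), kernelOp κ ^ i =
      (∑ i ∈ Finset.range (2 ^ n), kernelOp κ ^ i) * (1 + kernelOp κ ^ 2 ^ n) := by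
    rw [pow_succ 2 n, mul_two, Finset.sum_range_add, mul_add, mul_one, Finset.sum_mul]
    congr 1
    exact Finset.sum_congr rfl fun i _ => by rw [← pow_add, add_comm]
  rw [dyadicMeanOp, dyadicMeanOp, h, smul_mul_smul_comm, pow_succ, mul_inv]

theorem kernelOp_mul_dyadicMeanOp_sub (n : ℕ) :
    kernelOp κ * dyadicMeanOp κ n - dyadicMeanOp κ n =
      ((2 : ℝ) ^ n)⁻¹ • (kernelOp κ ^ 2 ^ n - 1) := by
  have h := (sub_one_mul (kernelOp κ) _).symm.trans (mul_geom_sum (kernelOp κ) (2 ^ n))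
  rw [dyadicMeanOp, mul_smul_comm]
  exact (smul_sub _ _ _).symm.trans (congrArg _ h)

/-- Dyadic means are almost invariant. -/
theorem abs_kernelOp_dyadicMeanOp_sub_le {f : BddMeas S} (hf : UnitFun f.1) (n : ℕ) (s : S) :
    |(kernelOp κ (dyadicMeanOp κ n f)).1 s - (dyadicMeanOp κ n f).1 s| ≤ 2 * (1 / 2) ^ n := by
  have h := congrArg (fun T : Module.End ℝ (BddMeas S) => (T f).1 s)
    (kernelOp_mul_dyadicMeanOp_sub κ n)
  have h' : (kernelOp κ (dyadicMeanOp κ n f)).1 s - (dyadicMeanOp κ n f).1 s =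
      ((2 : ℝ) ^ n)⁻¹ * (((kernelOp κ ^ 2 ^ n) f).1 s - f.1 s) := h
  rw [h', abs_mul, abs_of_pos (by positivity), mul_comm, one_div, inv_pow]
  refine mul_le_mul_of_nonneg_right ?_ (by positivity)
  have h1 := abs_le.1 ((hf.kernelOp_pow κ (2 ^ n)).2 s)
  have h2 := abs_le.1 (hf.2 s)
  rw [abs_le]
  constructor <;> linarith

/-- The images of a measure under the powers of a kernel. -/
def iterMeasure (α : Measure S) : ℕ → Measure S
  | 0 => α
  | n + 1 => κ ∘ₘ iterMeasure α n

/-- The average of the images of a measure under the first `2 ^ n` powers of a kernel. -/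
def dyadicMean (α : Measure S) (n : ℕ) : Measure S :=
  ((2 : ENNReal) ^ n)⁻¹ • ∑ i ∈ Finset.range (2 ^ n), iterMeasure κ α i

variable (α : Measure S) [IsProbabilityMeasure α]

instance isProbabilityMeasure_iterMeasure (n : ℕ) :
    IsProbabilityMeasure (iterMeasure κ α n) := by
  induction n with
  | zero => assumption
  | succ n ih =>
    rw [iterMeasure]
    infer_instance

instance isProbabilityMeasure_dyadicMean (n : ℕ) : IsProbabilityMeasure (dyadicMean κ α n) := by
  constructor
  rw [dyadicMean, Measure.smul_apply, Measure.finsetSum_apply]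
  simp only [measure_univ, Finset.sum_const, Finset.card_range, smul_eq_mul, nsmul_eq_mul, mul_one]
  push_cast
  exact ENNReal.inv_mul_cancel (by simp) (by simp)

end

theorem integral_comp_measure {Y Z : Type*} [MeasurableSpace Y] [MeasurableSpace Z]
    (κ : Kernel Y Z) [IsMarkovKernel κ] (μ : Measure Y) [IsProbabilityMeasure μ] {f : Z → ℝ}
    (hf : Integrable f (κ ∘ₘ μ)) : ∫ z, f z ∂(κ ∘ₘ μ) = ∫ y, ∫ z, f z ∂(κ y) ∂μ := by
  have := Kernel.integral_comp (η := κ) (κ := Kernel.const Unit μ) (a := ()) (f := f)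
    (by rwa [Kernel.comp_apply])
  rwa [Kernel.comp_apply] at this

section

variable (κ : Kernel S S) [IsMarkovKernel κ] (α : Measure S) [IsProbabilityMeasure α]

theorem integral_iterMeasure (n : ℕ) (f : BddMeas S) :
    ∫ s, f.1 s ∂(iterMeasure κ α n) = ∫ s, ((kernelOp κ ^ n) f).1 s ∂α := by
  induction n generalizing f with
  | zero => rfl
  | succ n ih =>
    rw [iterMeasure, integral_comp_measure κ _ (integrable_bddMeas f _)]
    exact (ih (kernelOp κ f)).trans (by rw [pow_succ]; rfl)

theorem integral_dyadicMean_eq_sum (n : ℕ) (f : BddMeas S) :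
    ∫ s, f.1 s ∂(dyadicMean κ α n) =
      ((2 : ℝ) ^ n)⁻¹ * ∑ i ∈ Finset.range (2 ^ n), ∫ s, f.1 s ∂(iterMeasure κ α i) := by
  rw [dyadicMean, integral_smul_measure, integral_finsetSum_measure fun i _ => integrable_bddMeas f _]
  simp

theorem integral_dyadicMean (n : ℕ) (f : BddMeas S) :
    ∫ s, f.1 s ∂(dyadicMean κ α n) = ∫ s, (dyadicMeanOp κ n f).1 s ∂α := by
  simp_rw [integral_dyadicMean_eq_sum, dyadicMeanOp_apply, integral_iterMeasure]
  rw [integral_const_mul, integral_finsetSum _ fun i _ => integrable_bddMeas ((kernelOp κ ^ i) f) _]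

/-- The extra factor in `dyadicMeanOp_succ` can be moved onto the test function, which keeps its
values in `[-1, 1]`. -/
theorem integral_dyadicMean_sub_le_succ {β : Measure S} [IsProbabilityMeasure β] {n : ℕ} {ε : ℝ}
    (h : ∀ f : S → ℝ, UnitFun f →
      ∫ s, f s ∂(dyadicMean κ α n) - ∫ s, f s ∂(dyadicMean κ β n) ≤ ε)
    {f : S → ℝ} (hf : UnitFun f) :
    ∫ s, f s ∂(dyadicMean κ α (n + 1)) - ∫ s, f s ∂(dyadicMean κ β (n + 1)) ≤ ε := by
  set g : BddMeas S := 
    ((2 : ℝ)⁻¹ • (1 + kernelOp κ ^ 2 ^ n) : Module.End ℝ (BddMeas S)) hf.toBddMeas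
  have key : ∀ (γ : Measure S) [IsProbabilityMeasure γ],
      ∫ s, f s ∂(dyadicMean κ γ (n + 1)) = ∫ s, g.1 s ∂(dyadicMean κ γ n) := by
    intro γ _
    rw [integral_dyadicMean]
    refine (integral_dyadicMean κ γ (n + 1) hf.toBddMeas).trans ?_
    rw [dyadicMeanOp_succ]
    rfl
  rw [key, key]
  refine h g.1 ⟨g.2.1, fun s => ?_⟩
  have h1 := abs_le.1 (hf.2 s)
  have hf' : UnitFun (hf.toBddMeas).1 := hf
  have h2 := abs_le.1 ((hf'.kernelOp_pow κ (2 ^ n)).2 s)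
  have h3 : g.1 s = 2⁻¹ * (f s + ((kernelOp κ ^ 2 ^ n) hf.toBddMeas).1 s) := rfl
  rw [h3, abs_le]
  constructor <;> linarith

theorem integral_dyadicMean_sub_le_of_le {β : Measure S} [IsProbabilityMeasure β] {n k : ℕ}
    (hnk : n ≤ k) {ε : ℝ} (h : ∀ f : S → ℝ, UnitFun f →
      ∫ s, f s ∂(dyadicMean κ α n) - ∫ s, f s ∂(dyadicMean κ β n) ≤ ε) :
    ∀ f : S → ℝ, UnitFun f →
      ∫ s, f s ∂(dyadicMean κ α k) - ∫ s, f s ∂(dyadicMean κ β k) ≤ ε := by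
  induction k, hnk using Nat.le_induction with
  | base => exact h
  | succ k _ ih => exact fun f hf => integral_dyadicMean_sub_le_succ κ α ih hf

/-- If the bounded harmonic functions of a Markov kernel with dominated transition probabilities
are constant, then the dyadic means started at two points merge in total variation. -/
theorem exists_integral_dyadicMean_sub_le (μ : Measure S) [IsFiniteMeasure μ]
    (hac : ∀ s, κ s ≪ μ)
    (hL : ∀ h : S → ℝ, UnitFun h → (∀ s, ∫ t, h t ∂(κ s) = h s) → ∀ s t, h s = h t)
    (s t : S) {ε : ℝ} (hε : 0 < ε) :
    ∃ n, ∀ f : S → ℝ, UnitFun f →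
      ∫ u, f u ∂(dyadicMean κ (κ s) n) - ∫ u, f u ∂(dyadicMean κ (κ t) n) ≤ ε := by
  by_contra! hcon
  have hint : ∀ {w : S → ℝ}, UnitFun w → ∀ u, Integrable w (κ u) := fun hw u => hw.integrable _
  -- Almost harmonic functions that separate `s` from `t`. If merging fails, dyadic means of bad
  -- test functions lie in these sets; a limit point would be a nonconstant bounded harmonic
  -- function.
  let C : ℕ → Set (S → ℝ) := fun n => {w | UnitFun w ∧
    (∀ u, |∫ v, w v ∂(κ u) - w u| ≤ 2 * (1 / 2) ^ n) ∧
    ε ≤ ∫ v, w v ∂(κ s) - ∫ v, w v ∂(κ t)}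
  have hanti : Antitone C := fun n k hnk w hw => ⟨hw.1, fun u => (hw.2.1 u).trans
    (mul_le_mul_of_nonneg_left (pow_le_pow_of_le_one (by norm_num) (by norm_num) hnk)
      zero_le_two), hw.2.2⟩
  have hconv : ∀ n, Convex ℝ (C n) := by
    intro n w ⟨hw, hw1, hw2⟩ z ⟨hz, hz1, hz2⟩ a b ha hb hab
    have hI : ∀ u, ∫ v, (a • w + b • z) v ∂(κ u) =
        a * ∫ v, w v ∂(κ u) + b * ∫ v, z v ∂(κ u) := by
      intro u
      simp only [Pi.add_apply, Pi.smul_apply, smul_eq_mul]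
      rw [integral_add ((hint hw u).const_mul a) ((hint hz u).const_mul b), integral_const_mul,
        integral_const_mul]
    have habs : ∀ {x y c : ℝ}, |x| ≤ c → |y| ≤ c → |a * x + b * y| ≤ c := by
      intro x y c hx hy
      calc |a * x + b * y| ≤ a * |x| + b * |y| := by
            refine (abs_add_le _ _).trans_eq ?_
            rw [abs_mul, abs_mul, abs_of_nonneg ha, abs_of_nonneg hb]
        _ ≤ a * c + b * c := add_le_add (mul_le_mul_of_nonneg_left hx ha)
            (mul_le_mul_of_nonneg_left hy hb)
        _ = c := by rw [← add_mul, hab, one_mul]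
    refine ⟨⟨(hw.1.const_smul a).add (hz.1.const_smul b), fun u => habs (hw.2 u) (hz.2 u)⟩,
      fun u => ?_, ?_⟩
    · rw [hI]
      convert habs (hw1 u) (hz1 u) using 2
      simp only [Pi.add_apply, Pi.smul_apply, smul_eq_mul]
      ring
    · rw [hI, hI]
      nlinarith [mul_le_mul_of_nonneg_left hw2 ha, mul_le_mul_of_nonneg_left hz2 hb]
  have hne : ∀ n, (C n).Nonempty := by
    intro n
    obtain ⟨f, hf, hlt⟩ := hcon n
    have hf' : UnitFun hf.toBddMeas.1 := hf
    refine ⟨(dyadicMeanOp κ n hf.toBddMeas).1, hf'.dyadicMeanOp κ n,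
      fun u => abs_kernelOp_dyadicMeanOp_sub_le κ hf' n u, ?_⟩
    rw [← integral_dyadicMean κ (κ s), ← integral_dyadicMean κ (κ t)]
    exact hlt.le
  obtain ⟨w, hw, h, hh, hae⟩ := exists_ae_tendsto_of_antitone_convex μ C hanti hconv hne
    fun f hf => hf.1
  have hdom : ∀ {g : S → ℝ} (u : S), (∀ᵐ v ∂(κ u), Tendsto (fun n => w n v) atTop (𝓝 (g v))) →
      Tendsto (fun n => ∫ v, w n v ∂(κ u)) atTop (𝓝 (∫ v, g v ∂(κ u))) := fun u hu =>
    tendsto_integral_filter_of_dominated_convergence (fun _ => 1)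
      (Eventually.of_forall fun n => (hw n).1.1.aestronglyMeasurable)
      (Eventually.of_forall fun n => ae_of_all _ fun v => (hw n).1.2 v) (integrable_const _) hu
  -- Convergence holds only `μ`-almost everywhere so far. Since `κ u ≪ μ`, the images of `w n` under
  -- `κ` converge everywhere, and almost harmonicity transfers this to `w n` itself. The everywhere
  -- defined limit `H` is then exactly harmonic.
  have hlim : ∀ u, Tendsto (fun n => w n u) atTop (𝓝 (∫ v, h v ∂(κ u))) := by
    intro u
    have h1 : Tendsto (fun n => ∫ v, w n v ∂(κ u) - w n u) atTop (𝓝 0) := by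
      refine squeeze_zero_norm (fun n => (hw n).2.1 u) ?_
      simpa using (tendsto_pow_atTop_nhds_zero_of_lt_one (r := (1 / 2 : ℝ)) (by norm_num)
        (by norm_num)).const_mul 2
    simpa using (hdom u ((hac u).ae_le hae)).sub h1
  set H : S → ℝ := fun u => ∫ v, h v ∂(κ u)
  have hHunit : UnitFun H := ⟨hh.stronglyMeasurable.integral_kernel.measurable, fun u =>
    le_of_tendsto (hlim u).abs (Eventually.of_forall fun n => (hw n).1.2 u)⟩
  have hH2 : ∀ u, ∫ v, H v ∂(κ u) = H u := fun u =>
    tendsto_nhds_unique (hdom u (ae_of_all _ hlim)) (hdom u ((hac u).ae_le hae))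
  have h3 : ε ≤ H s - H t := ge_of_tendsto ((hdom s ((hac s).ae_le hae)).sub
    (hdom t ((hac t).ae_le hae))) (Eventually.of_forall fun n => (hw n).2.2)
  rw [hL H hHunit hH2 s t] at h3
  linarith

end

end DyadicMeans

/-! ### An equivariant Markov kernel from a proper `G`-space to `G` -/

theorem isCompact_setOf_inv_smul_mem {G S : Type*} [Group G] [TopologicalSpace G]
    [IsTopologicalGroup G] [TopologicalSpace S] [T2Space S] [MulAction G S] [ProperSMul G S]
    {K : Set S} (hK : IsCompact K) (s : S) : IsCompact {h : G | h⁻¹ • s ∈ K} := by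
  have h1 := (ProperSMul.isProperMap_smul_pair (G := G) (X := S)).isCompact_preimage
    ((isCompact_singleton (x := s)).prod hK)
  refine (h1.image continuous_fst).of_isClosed_subset ?_ ?_
  · have hcont : Continuous fun h : G => h⁻¹ • s := by
      have : ContinuousSMul G S := inferInstance
      fun_prop
    exact hK.isClosed.preimage hcont
  · intro h hh
    exact ⟨(h, h⁻¹ • s), ⟨by simp, hh⟩, rfl⟩

/-- A proper action admits a measurable set whose sets of return times all have positive and
finite Haar measure. -/
theorem exists_measurableSet_haar_pos_finite (G : Type*) {S : Type*} [Group G] [TopologicalSpace G]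
    [IsTopologicalGroup G] [LocallyCompactSpace G] [MeasurableSpace G] [BorelSpace G]
    [TopologicalSpace S] [LocallyCompactSpace S] [T2Space S] [SecondCountableTopology S]
    [MeasurableSpace S] [BorelSpace S] [MulAction G S] [ContinuousSMul G S] [ProperSMul G S] :
    ∃ W : Set S, MeasurableSet W ∧ ∀ s : S, (Measure.haar {h : G | h⁻¹ • s ∈ W}) ≠ 0 ∧
      (Measure.haar {h : G | h⁻¹ • s ∈ W}) ≠ ⊤ := by
  classical
  let K := CompactExhaustion.choice S
  let U : ℕ → Set S := fun n => interior (K n)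
  let A : ℕ → Set S := fun n => ⋃ g : G, (fun s => g⁻¹ • s) ⁻¹' U n
  -- The `A n` are the saturations of the relatively compact open sets `U n`. Making them disjoint
  -- keeps the pieces invariant, so each orbit lies in one piece and meets `W` exactly where it
  -- meets the corresponding `U n`: its set of return times is nonempty, open and relatively
  -- compact.
  have hAopen : ∀ n, IsOpen (A n) := fun n => isOpen_iUnion fun g =>
    isOpen_interior.preimage (continuous_const_smul _)
  have hAinv : ∀ n (g : G) s, g • s ∈ A n ↔ s ∈ A n := by
    intro n g s
    simp only [A, Set.mem_iUnion, Set.mem_preimage]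
    constructor
    · rintro ⟨h, hh⟩
      exact ⟨g⁻¹ * h, by simpa [mul_smul] using hh⟩
    · rintro ⟨h, hh⟩
      exact ⟨g * h, by simpa [mul_smul] using hh⟩
  have hEinv : ∀ n (g : G) s, g • s ∈ disjointed A n ↔ s ∈ disjointed A n := by
    intro n g s
    simp only [disjointed_eq_inter_compl, Set.mem_inter_iff, Set.mem_iInter, Set.mem_compl_iff,
      hAinv]
  have hE : ∀ s, ∃ n, s ∈ disjointed A n := by
    intro s
    have : s ∈ ⋃ n, disjointed A n := by
      rw [iUnion_disjointed]
      obtain ⟨n, hn⟩ := K.exists_mem s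
      exact Set.mem_iUnion.2 ⟨n + 1, Set.mem_iUnion.2 ⟨1, by
        simpa using K.subset_interior_succ n hn⟩⟩
    simpa using this
  refine ⟨⋃ n, disjointed A n ∩ U n, MeasurableSet.iUnion fun n =>
    (MeasurableSet.disjointed (fun n => (hAopen n).measurableSet) n).inter
      isOpen_interior.measurableSet, fun s => ?_⟩
  obtain ⟨n, hn⟩ := hE s
  have hset : {h : G | h⁻¹ • s ∈ ⋃ n, disjointed A n ∩ U n} = {h : G | h⁻¹ • s ∈ U n} := by
    ext h
    simp only [Set.mem_ofPred_eq, Set.mem_iUnion, Set.mem_inter_iff, hEinv]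
    constructor
    · rintro ⟨k, hk, hU⟩
      by_cases hkn : k = n
      · rwa [← hkn]
      · exact absurd hn (Set.disjoint_left.1 (disjoint_disjointed A hkn) hk)
    · exact fun hU => ⟨n, hn, hU⟩
  rw [hset]
  constructor
  · have hopen : IsOpen {h : G | h⁻¹ • s ∈ U n} :=
      isOpen_interior.preimage (by fun_prop : Continuous fun h : G => h⁻¹ • s)
    have hne : {h : G | h⁻¹ • s ∈ U n}.Nonempty := by
      obtain ⟨g, hg⟩ := Set.mem_iUnion.1 (disjointed_subset A n hn)
      exact ⟨g, hg⟩
    exact (hopen.measure_pos _ hne).ne'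
  · exact ((measure_mono (show {h : G | h⁻¹ • s ∈ U n} ⊆ {h : G | h⁻¹ • s ∈ K n} from
      fun h hh => interior_subset (s := K n) hh)).trans_lt
      (isCompact_setOf_inv_smul_mem (K.isCompact n) s).measure_lt_top).ne

/-- Condition Haar measure on the return times `{h | h⁻¹ • s ∈ W}`. Moving `s` by `g` left
translates this set by `g`, and Haar measure is left invariant. Measurability in `s` suffices, since
continuity will come from total variation convergence on `S`. -/
theorem exists_equivariant_markovKernel (G S : Type*) [Group G] [TopologicalSpace G]
    [IsTopologicalGroup G] [LocallyCompactSpace G] [SecondCountableTopology G]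
    [MeasurableSpace G] [BorelSpace G]
    [TopologicalSpace S] [LocallyCompactSpace S] [T2Space S] [SecondCountableTopology S]
    [MeasurableSpace S] [BorelSpace S] [MulAction G S] [ContinuousSMul G S] [ProperSMul G S] :
    ∃ T : Kernel S G, IsMarkovKernel T ∧
      ∀ (g : G) (s : S), T (g • s) = (T s).map (fun h => g * h) := by
  obtain ⟨W, hW, hpos⟩ := exists_measurableSet_haar_pos_finite G (S := S)
  have hE : MeasurableSet ((fun z : S × G => z.2⁻¹ • z.1) ⁻¹' W) :=
    hW.preimage (by fun_prop : Continuous fun z : S × G => z.2⁻¹ • z.1).measurable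
  have hN : ∀ s : S, MeasurableSet {h : G | h⁻¹ • s ∈ W} := fun s => measurable_prodMk_left hE
  let T : Kernel S G :=
    { toFun := fun s => ProbabilityTheory.cond Measure.haar {h : G | h⁻¹ • s ∈ W}
      measurable' := by
        refine Measure.measurable_of_measurable_coe _ fun B hB => ?_
        simp_rw [cond_apply (hN _)]
        exact (measurable_measure_prodMk_left hE).inv.mul
          (measurable_measure_prodMk_left (hE.inter (measurable_snd hB))) }
  refine ⟨T, ⟨fun s => cond_isProbabilityMeasure_of_finite (hpos s).1 (hpos s).2⟩,
    fun g s => ?_⟩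
  have hshift : (fun h => g * h) ⁻¹' {h : G | h⁻¹ • g • s ∈ W} = {h : G | h⁻¹ • s ∈ W} := by
    ext h
    simp [mul_smul]
  ext B hB
  rw [Measure.map_apply (measurable_const_mul g) hB]
  change ProbabilityTheory.cond Measure.haar _ B = ProbabilityTheory.cond Measure.haar _ _
  rw [cond_apply (hN _), cond_apply (hN _), ← measure_preimage_mul Measure.haar g,
    ← measure_preimage_mul Measure.haar g ({h : G | h⁻¹ • g • s ∈ W} ∩ B), Set.preimage_inter,
    hshift]

/-! ### Doob transforms -/

section Doob

variable {S : Type*} [MeasurableSpace S] (π : Kernel S S) [IsMarkovKernel π]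

/-- The Doob transform of a Markov kernel by a positive function. -/
def doob (f : S → ℝ) : Kernel S S := π.withDensity (fun s t => ENNReal.ofReal (f t / f s))

variable {π} {f : S → ℝ}

theorem measurable_doob_density (hf : Measurable f) :
    Measurable (Function.uncurry fun s t : S => ENNReal.ofReal (f t / f s)) :=
  ((hf.comp measurable_snd).div (hf.comp measurable_fst)).ennreal_ofReal

theorem doob_apply (hf : Measurable f) (s : S) :
    doob π f s = (π s).withDensity (fun t => ENNReal.ofReal (f t / f s)) :=
  Kernel.withDensity_apply π (measurable_doob_density hf) s

theorem isMarkovKernel_doob (hf : IsHarmonic π f) (hpos : ∀ s, 0 < f s) :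
    IsMarkovKernel (doob π f) := by
  refine ⟨fun s => ⟨?_⟩⟩
  rw [doob_apply hf.1, withDensity_apply _ MeasurableSet.univ, Measure.restrict_univ,
    ← ofReal_integral_eq_lintegral_ofReal ((hf.2 s).1.div_const _)
      (ae_of_all _ fun t => (div_pos (hpos t) (hpos s)).le), integral_div, (hf.2 s).2,
    div_self (hpos s).ne', ENNReal.ofReal_one]

theorem integral_doob (hf : Measurable f) (hpos : ∀ s, 0 < f s) (s : S) (h : S → ℝ) :
    ∫ t, h t ∂(doob π f s) = ∫ t, f t / f s * h t ∂(π s) := by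
  rw [doob_apply hf, integral_withDensity_eq_integral_toReal_smul
    (by fun_prop) (ae_of_all _ fun t => ENNReal.ofReal_lt_top)]
  refine integral_congr_ae (ae_of_all _ fun t => ?_)
  simp only [smul_eq_mul]
  rw [ENNReal.toReal_ofReal (div_pos (hpos t) (hpos s)).le]

theorem doob_absolutelyContinuous (hf : Measurable f) (s : S) : doob π f s ≪ π s := by
  rw [doob_apply hf]
  exact withDensity_absolutelyContinuous _ _

/-- Bounded harmonic functions of the Doob transform by a minimal function are constant. -/
theorem IsMinimalPositiveHarmonic.eq_of_doob_harmonic (hf : IsMinimalPositiveHarmonic π f)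
    {h : S → ℝ} (hh : UnitFun h) (hharm : ∀ s, ∫ t, h t ∂(doob π f s) = h s) (s t : S) :
    h s = h t := by
  obtain ⟨hfh, hpos, hmin⟩ := hf
  have hint : ∀ s, Integrable (fun t => f t * h t) (π s) := fun s =>
    (hfh.2 s).1.mul_bdd (c := 1) hh.1.aestronglyMeasurable (ae_of_all _ fun t => hh.2 t)
  have hval : ∀ s, ∫ t, f t * h t ∂(π s) = f s * h s := by
    intro s
    have h1 := hharm s
    rw [integral_doob hfh.1 hpos] at h1
    have h2 : ∀ t, f t / f s * h t = (f s)⁻¹ * (f t * h t) := fun t => by ring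
    simp_rw [h2] at h1
    rw [integral_const_mul] at h1
    rw [← h1, mul_inv_cancel_left₀ (hpos s).ne']
  -- As `|h| ≤ 1`, the harmonic function `f (1 + h) / 2` lies between `0` and `f`.
  obtain ⟨c, hc⟩ := hmin (fun s => 2⁻¹ * (f s + f s * h s))
    ⟨(hfh.1.add (hfh.1.mul hh.1)).const_mul _, fun s =>
      ⟨((hfh.2 s).1.add (hint s)).const_mul _, by
        rw [integral_const_mul, integral_add (hfh.2 s).1 (hint s), (hfh.2 s).2, hval]⟩⟩
    (fun s => by
      have := neg_le_of_abs_le (hh.2 s)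
      have := hpos s
      nlinarith)
    (fun s => by
      have := le_of_abs_le (hh.2 s)
      have := hpos s
      nlinarith)
  have hconst : ∀ s, h s = 2 * c - 1 := by
    intro s
    have h1 := hc s
    have h2 : f s * (h s - (2 * c - 1)) = 0 := by linear_combination 2 * h1
    rcases mul_eq_zero.1 h2 with h3 | h3
    · exact absurd h3 (hpos s).ne'
    · linarith
  rw [hconst, hconst]

end Doob

/-! ### Kernels with continuous densities -/

section Density

variable {S : Type*} [TopologicalSpace S] [MeasurableSpace S] [BorelSpace S]
  {π : Kernel S S} {m : Measure S} {p : S → S → NNReal}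

theorem integral_density (hp : Continuous (Function.uncurry p))
    (hπ : ∀ s, π s = m.withDensity (fun t => (p s t : ENNReal))) (s : S) (f : S → ℝ) :
    ∫ t, f t ∂(π s) = ∫ t, (p s t : ℝ) * f t ∂m := by
  rw [hπ, integral_withDensity_eq_integral_smul
    (by fun_prop : Continuous fun t => p s t).measurable]
  rfl

theorem integrable_density_mul (hp : Continuous (Function.uncurry p))
    (hπ : ∀ s, π s = m.withDensity (fun t => (p s t : ENNReal))) {s : S} {f : S → ℝ}
    (hf : Integrable f (π s)) : Integrable (fun t => (p s t : ℝ) * f t) m := by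
  rw [hπ, integrable_withDensity_iff_integrable_smul
    (by fun_prop : Continuous fun t => p s t).measurable] at hf
  exact hf

/-- A set null for `π s` along a dense sequence of `s` is null for all `s`, by continuity of `p` in
its first variable. -/
theorem exists_dominating_measure [SecondCountableTopology S] [Nonempty S] [IsMarkovKernel π]
    (hp : Continuous (Function.uncurry p))
    (hπ : ∀ s, π s = m.withDensity (fun t => (p s t : ENNReal))) :
    ∃ μ : Measure S, IsFiniteMeasure μ ∧ ∀ s, π s ≪ μ := by
  let ν : Measure S := Measure.sum fun i => π (TopologicalSpace.denseSeq S i)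
  refine ⟨ν.toFinite, inferInstance, fun s => ?_⟩
  refine Measure.AbsolutelyContinuous.trans (Measure.AbsolutelyContinuous.mk fun A hA h0 => ?_)
    (absolutelyContinuous_toFinite ν)
  have hmeas : ∀ s, Measurable fun t => (p s t : ENNReal) := fun s =>
    (by fun_prop : Continuous fun t => p s t).measurable.coe_nnreal_ennreal
  rw [Measure.sum_apply _ hA, ENNReal.tsum_eq_zero] at h0
  have h1 : ∀ i, ∀ᵐ t ∂(m.restrict A), p (TopologicalSpace.denseSeq S i) t = 0 := by
    intro i
    have h2 := h0 i
    rw [hπ, withDensity_apply _ hA, lintegral_eq_zero_iff (hmeas _)] at h2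
    filter_upwards [h2] with t ht
    simpa using ht
  rw [hπ, withDensity_apply _ hA, lintegral_eq_zero_iff (hmeas _)]
  filter_upwards [ae_all_iff.2 h1] with t ht
  have hcont : Continuous fun u => p u t := by fun_prop
  have h3 : (fun u => p u t) = fun _ => 0 :=
    hcont.ext_on (TopologicalSpace.denseRange_denseSeq S) continuous_const (by
      rintro _ ⟨i, rfl⟩
      exact ht i)
  simpa using congrFun h3 s

end Density

/-! ### Equivariant families of minimal harmonic functions -/

/-- A `G`-equivariant, pointwise continuous family of minimal positive harmonic functions
normalized at a base point. -/
structure MinimalFamily (G : Type*) {S X : Type*} [Group G] [MulAction G S] [MulAction G X]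
    [TopologicalSpace X] [MeasurableSpace S] (π : Kernel S S) (o : S) (φ : X → S → ℝ) :
    Prop where
  minimal : ∀ x, IsMinimalPositiveHarmonic π (φ x)
  cont : ∀ s, Continuous fun x => φ x s
  base : ∀ x, φ x o = 1
  -- The factor `φ x (g⁻¹ • o)` restores the normalization at `o` after translation by `g`.
  equivariant : ∀ (g : G) x s, φ (g • x) (g • s) * φ x (g⁻¹ • o) = φ x s

namespace MinimalFamily

section Basic

variable {G S X : Type*} [Group G] [MulAction G S] [MulAction G X]
    [TopologicalSpace X] [MeasurableSpace S] {π : Kernel S S} {o : S}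
    {φ : X → S → ℝ}

theorem pos (H : MinimalFamily G π o φ) (x : X) (s : S) : 0 < φ x s := (H.minimal x).2.1 s

theorem measurable (H : MinimalFamily G π o φ) (x : X) : Measurable (φ x) := (H.minimal x).1.1

theorem integrable (H : MinimalFamily G π o φ) (x : X) (s : S) : Integrable (φ x) (π s) :=
  ((H.minimal x).1.2 s).1

theorem integral_eq (H : MinimalFamily G π o φ) (x : X) (s : S) : ∫ t, φ x t ∂(π s) = φ x s :=
  ((H.minimal x).1.2 s).2

theorem integral_div_eq_one (H : MinimalFamily G π o φ) (x : X) (s : S) :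
    ∫ t, φ x t / φ x s ∂(π s) = 1 := by
  rw [integral_div, H.integral_eq, div_self (H.pos x s).ne']

variable [IsMarkovKernel π]

/-- The Doob transforms by the functions of the family. -/
def kernel (_H : MinimalFamily G π o φ) (x : X) : Kernel S S := doob π (φ x)

instance (H : MinimalFamily G π o φ) (x : X) : IsMarkovKernel (H.kernel x) :=
  isMarkovKernel_doob (H.minimal x).1 (H.pos x)

theorem integral_kernel (H : MinimalFamily G π o φ) (x : X) (s : S) (h : S → ℝ) :
    ∫ t, h t ∂(H.kernel x s) = ∫ t, φ x t / φ x s * h t ∂(π s) :=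
  integral_doob (H.measurable x) (H.pos x) s h

/-- The Doob density involves only quotients of values of `φ x`, from which the normalizing factor
cancels. -/
theorem kernel_smul [TopologicalSpace G] [TopologicalSpace S] [BorelSpace S] [ContinuousSMul G S]
    (H : MinimalFamily G π o φ) (hinv : IsInvariantOperator G π) (g : G) (x : X) (s : S) :
    H.kernel (g • x) (g • s) = (H.kernel x s).map (fun t => g • t) := by
  have hg : Measurable fun t : S => g • t := (continuous_const_smul g).measurable
  ext B hB
  rw [Measure.map_apply hg hB, kernel, kernel, doob_apply (H.measurable _),
    doob_apply (H.measurable _), withDensity_apply _ hB, withDensity_apply _ (hg hB), hinv g s,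
    setLIntegral_map hB ((H.measurable _).div_const _).ennreal_ofReal hg]
  refine lintegral_congr fun t => ?_
  have h1 := H.equivariant g x t
  have h2 := H.equivariant g x s
  congr 1
  rw [← h1, ← h2, mul_div_mul_right _ _ (H.pos x _).ne']

variable {ι : Type*} {l : Filter ι} [l.IsCountablyGenerated]

/-- Applying the Doob transforms preserves convergence in total variation. -/
theorem tvTendsto_comp (H : MinimalFamily G π o φ) {y : ι → X} {y₀ : X}
    (hy : Tendsto y l (𝓝 y₀)) {ν : ι → Measure S} {ν₀ : Measure S}
    [∀ i, IsProbabilityMeasure (ν i)] [IsProbabilityMeasure ν₀] (hν : TVTendsto ν l ν₀) :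
    TVTendsto (fun i => H.kernel (y i) ∘ₘ ν i) l (H.kernel y₀ ∘ₘ ν₀) := by
  -- `D i s` bounds the distance between the two transforms at a fixed `s`. It tends to `0` by
  -- Scheffé and is at most `2`, so its integral against the fixed measure `ν₀` vanishes in the
  -- limit; replacing `ν i` by `ν₀` costs only the distance between them.
  let D : ι → S → ℝ := fun i s => ∫ t, |φ (y i) t / φ (y i) s - φ y₀ t / φ y₀ s| ∂(π s)
  have hdiv : ∀ x s, Integrable (fun t => φ x t / φ x s) (π s) := fun x s =>
    (H.integrable x s).div_const _
  have hdiv0 : ∀ x s t, 0 ≤ φ x t / φ x s := fun x s t => (div_pos (H.pos x t) (H.pos x s)).le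
  have hDmeas : ∀ i, StronglyMeasurable (D i) := by
    intro i
    have h1 := H.measurable (y i)
    have h2 := H.measurable y₀
    refine StronglyMeasurable.integral_kernel_prod_right
      (f := fun s t => |φ (y i) t / φ (y i) s - φ y₀ t / φ y₀ s|) (Measurable.stronglyMeasurable ?_)
    exact (((h1.comp measurable_snd).div (h1.comp measurable_fst)).sub
      ((h2.comp measurable_snd).div (h2.comp measurable_fst))).abs
  have hD0 : ∀ i s, 0 ≤ D i s := fun i s => integral_nonneg fun t => abs_nonneg _
  have hD2 : ∀ i s, ‖D i s‖ ≤ 2 := by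
    intro i s
    rw [Real.norm_of_nonneg (hD0 i s)]
    calc D i s ≤ ∫ t, (φ (y i) t / φ (y i) s + φ y₀ t / φ y₀ s) ∂(π s) := by
          refine integral_mono ((hdiv _ s).sub (hdiv _ s)).abs ((hdiv _ s).add (hdiv _ s))
            fun t => ?_
          refine (abs_sub _ _).trans_eq ?_
          rw [abs_of_nonneg (hdiv0 _ _ _), abs_of_nonneg (hdiv0 _ _ _)]
      _ = 2 := by
          rw [integral_add (hdiv _ s) (hdiv _ s), H.integral_div_eq_one, H.integral_div_eq_one]
          norm_num
  have hDlim : ∀ s, Tendsto (fun i => D i s) l (𝓝 0) := by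
    intro s
    refine tendsto_integral_abs_sub (fun i => hdiv (y i) s) (fun i => hdiv0 (y i) s) (hdiv y₀ s)
      (hdiv0 y₀ s) (fun t => (((H.cont t).tendsto y₀).comp hy).div
        (((H.cont s).tendsto y₀).comp hy) (H.pos _ _).ne') ?_
    simp_rw [H.integral_div_eq_one]
    exact tendsto_const_nhds
  have hDint : Tendsto (fun i => ∫ s, D i s ∂ν₀) l (𝓝 0) := by
    have := tendsto_integral_filter_of_dominated_convergence (μ := ν₀) (l := l) (F := D)
      (f := fun _ => 0) (fun _ => 2)
      (Eventually.of_forall fun i => (hDmeas i).aestronglyMeasurable)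
      (Eventually.of_forall fun i => ae_of_all _ (hD2 i)) (integrable_const _)
      (ae_of_all _ hDlim)
    simpa using this
  intro ε hε
  filter_upwards [hν (ε / 2) (half_pos hε), hDint.eventually (gt_mem_nhds (half_pos hε))]
    with i h1 h2 f hf
  rw [integral_comp_measure _ _ (hf.integrable _), integral_comp_measure _ _ (hf.integrable _)]
  have hUi := hf.kernel_integral (H.kernel (y i))
  have hU0 := hf.kernel_integral (H.kernel y₀)
  have h3 := h1 _ hUi
  have h4 : |∫ s, ∫ t, f t ∂(H.kernel (y i) s) ∂ν₀ - ∫ s, ∫ t, f t ∂(H.kernel y₀ s) ∂ν₀| ≤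
      ∫ s, D i s ∂ν₀ := by
    rw [← integral_sub (hUi.integrable _) (hU0.integrable _)]
    refine abs_integral_le_integral_abs.trans (integral_mono_of_nonneg
      (ae_of_all _ fun s => abs_nonneg _)
      (Integrable.of_bound (hDmeas i).aestronglyMeasurable 2 (ae_of_all _ (hD2 i)))
      (ae_of_all _ fun s => ?_))
    simp only
    rw [H.integral_kernel, H.integral_kernel]
    exact abs_integral_mul_sub_le hf (hdiv _ s) (hdiv _ s)
  have h5 := abs_sub_le (∫ s, ∫ t, f t ∂(H.kernel (y i) s) ∂(ν i))
    (∫ s, ∫ t, f t ∂(H.kernel (y i) s) ∂ν₀) (∫ s, ∫ t, f t ∂(H.kernel y₀ s) ∂ν₀)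
  linarith

theorem tvTendsto_dyadicMean (H : MinimalFamily G π o φ) {y : ι → X} {y₀ : X}
    (hy : Tendsto y l (𝓝 y₀)) {ν : ι → Measure S} {ν₀ : Measure S}
    [∀ i, IsProbabilityMeasure (ν i)] [IsProbabilityMeasure ν₀] (hν : TVTendsto ν l ν₀) (n : ℕ) :
    TVTendsto (fun i => dyadicMean (H.kernel (y i)) (ν i) n) l
      (dyadicMean (H.kernel y₀) ν₀ n) := by
  have hiter : ∀ j, TVTendsto (fun i => iterMeasure (H.kernel (y i)) (ν i) j) l
      (iterMeasure (H.kernel y₀) ν₀ j) := by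
    intro j
    induction j with
    | zero => exact hν
    | succ j ih => exact H.tvTendsto_comp hy ih
  intro ε hε
  filter_upwards [(Finset.range (2 ^ n)).eventually_all.2 fun j _ => hiter j ε hε]
    with i hi f hf
  have hsum := fun (κ : Kernel S S) [IsMarkovKernel κ] (α : Measure S) [IsProbabilityMeasure α] =>
    integral_dyadicMean_eq_sum κ α n hf.toBddMeas
  have e1 := hsum (H.kernel (y i)) (ν i)
  have e2 := hsum (H.kernel y₀) ν₀
  change ∫ s, f s ∂_ = _ at e1
  change ∫ s, f s ∂_ = _ at e2
  rw [e1, e2, ← mul_sub, ← Finset.sum_sub_distrib, abs_mul, abs_of_pos (by positivity),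
    inv_mul_le_iff₀ (by positivity)]
  refine (Finset.abs_sum_le_sum_abs _ _).trans
    ((Finset.sum_le_sum fun j hj => hi j hj f hf).trans ?_)
  simp

end Basic

/-! ### Joint continuity in the group element and the parameter -/

section Continuity

variable {G S X : Type*} [Group G] [MulAction G S] [MulAction G X]
    [TopologicalSpace X] [TopologicalSpace S] [MeasurableSpace S] [BorelSpace S]
    {π : Kernel S S} {o : S}
    {φ : X → S → ℝ} {m : Measure S} {p : S → S → NNReal}
    {ι : Type*} {l : Filter ι} [l.IsCountablyGenerated]

/-- Writing `φ x u` as the `m`-integral of `p u t * φ x t` turns pointwise convergence of the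
integrands into joint lower semicontinuity. -/
theorem eventually_lt (H : MinimalFamily G π o φ) (hp : Continuous (Function.uncurry p))
    (hπ : ∀ s, π s = m.withDensity (fun t => (p s t : ENNReal))) {s : ι → S} {s₀ : S}
    (hs : Tendsto s l (𝓝 s₀)) {y : ι → X} {y₀ : X} (hy : Tendsto y l (𝓝 y₀)) {c : ℝ}
    (hc : c < φ y₀ s₀) : ∀ᶠ i in l, c < φ (y i) (s i) := by
  have hint : ∀ x u, Integrable (fun t => (p u t : ℝ) * φ x t) m := fun x u =>
    integrable_density_mul hp hπ (H.integrable x u)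
  have hval : ∀ x u, ∫ t, (p u t : ℝ) * φ x t ∂m = φ x u := fun x u => by
    rw [← integral_density hp hπ, H.integral_eq]
  have hnn : ∀ x u t, 0 ≤ (p u t : ℝ) * φ x t := fun x u t =>
    mul_nonneg (p u t).2 (H.pos x t).le
  have h1 := tendsto_integral_min (l := l) (fun i => hint (y i) (s i)) (fun i => hnn (y i) (s i))
    (hint y₀ s₀) (hnn y₀ s₀) (fun t =>
      (((by fun_prop : Continuous fun u => (p u t : ℝ)).tendsto s₀).comp hs).mul
        (((H.cont t).tendsto y₀).comp hy))
  rw [hval] at h1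
  filter_upwards [h1.eventually (lt_mem_nhds hc)] with i hi
  refine hi.trans_le ?_
  rw [← hval (y i) (s i)]
  exact integral_mono ((hint _ _).inf (hint _ _)) (hint _ _) fun t => min_le_left _ _

/-- The value is the reciprocal of `φ x (g⁻¹ • o)`; lower semicontinuity of the reciprocal is the
missing upper semicontinuity. -/
theorem tendsto_smul_base [TopologicalSpace G] [IsTopologicalGroup G] [ContinuousSMul G S]
    [ContinuousSMul G X] (H : MinimalFamily G π o φ) (hp : Continuous (Function.uncurry p))
    (hπ : ∀ s, π s = m.withDensity (fun t => (p s t : ENNReal))) {g : ι → G} {g₀ : G}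
    (hg : Tendsto g l (𝓝 g₀)) {x : ι → X} {x₀ : X} (hx : Tendsto x l (𝓝 x₀)) :
    Tendsto (fun i => φ (g i • x i) (g i • o)) l (𝓝 (φ (g₀ • x₀) (g₀ • o))) := by
  have hmul : ∀ (g : G) x, φ (g • x) (g • o) * φ x (g⁻¹ • o) = 1 := fun g x => by
    rw [H.equivariant, H.base]
  rw [tendsto_order]
  refine ⟨fun c hc => H.eventually_lt hp hπ (hg.smul_const o) (hg.smul hx) hc, fun c hc => ?_⟩
  have hc0 : 0 < c := (H.pos _ _).trans hc
  have h1 : c⁻¹ < φ x₀ (g₀⁻¹ • o) := by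
    rw [inv_lt_iff_one_lt_mul₀ hc0, ← hmul g₀ x₀]
    rw [mul_comm]
    exact (mul_lt_mul_iff_right₀ (H.pos _ _)).2 hc
  filter_upwards [H.eventually_lt hp hπ (hg.inv.smul_const o) hx h1] with i hi
  rw [inv_lt_iff_one_lt_mul₀ hc0, ← hmul (g i) (x i)] at hi
  rw [mul_comm] at hi
  exact (mul_lt_mul_iff_right₀ (H.pos _ _)).1 hi

variable [IsMarkovKernel π]

/-- Transition probabilities of the Doob transforms depend continuously, in total variation, on
parameters along which the normalization is continuous. -/
theorem tvTendsto_kernel (H : MinimalFamily G π o φ) (hp : Continuous (Function.uncurry p))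
    (hπ : ∀ s, π s = m.withDensity (fun t => (p s t : ENNReal))) {s : ι → S} {s₀ : S}
    (hs : Tendsto s l (𝓝 s₀)) {y : ι → X} {y₀ : X} (hy : Tendsto y l (𝓝 y₀))
    (hφ : Tendsto (fun i => φ (y i) (s i)) l (𝓝 (φ y₀ s₀))) :
    TVTendsto (fun i => H.kernel (y i) (s i)) l (H.kernel y₀ s₀) := by
  have hint : ∀ x u, Integrable (fun t => (p u t : ℝ) * (φ x t / φ x u)) m := fun x u =>
    integrable_density_mul hp hπ ((H.integrable x u).div_const _)
  have hval : ∀ x u, ∫ t, (p u t : ℝ) * (φ x t / φ x u) ∂m = 1 := fun x u => by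
    rw [← integral_density hp hπ, H.integral_div_eq_one]
  have hnn : ∀ x u t, 0 ≤ (p u t : ℝ) * (φ x t / φ x u) := fun x u t =>
    mul_nonneg (p u t).2 (div_pos (H.pos x t) (H.pos x u)).le
  have h1 := tendsto_integral_abs_sub (l := l) (fun i => hint (y i) (s i))
    (fun i => hnn (y i) (s i)) (hint y₀ s₀) (hnn y₀ s₀) (fun t =>
      (((by fun_prop : Continuous fun u => (p u t : ℝ)).tendsto s₀).comp hs).mul
        ((((H.cont t).tendsto y₀).comp hy).div hφ (H.pos _ _).ne'))
    (by simp_rw [hval]; exact tendsto_const_nhds)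
  intro ε hε
  filter_upwards [h1.eventually (gt_mem_nhds hε)] with i hi f hf
  have hI : ∀ x u, ∫ t, f t ∂(H.kernel x u) = ∫ t, (p u t : ℝ) * (φ x t / φ x u) * f t ∂m := by
    intro x u
    rw [H.integral_kernel, integral_density hp hπ]
    simp_rw [mul_assoc]
  rw [hI, hI]
  exact (abs_integral_mul_sub_le hf (hint _ _) (hint _ _)).trans hi.le

theorem tvTendsto_dyadicMean_base (H : MinimalFamily G π o φ)
    (hp : Continuous (Function.uncurry p))
    (hπ : ∀ s, π s = m.withDensity (fun t => (p s t : ENNReal))) {y : ι → X} {y₀ : X}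
    (hy : Tendsto y l (𝓝 y₀)) (n : ℕ) :
    TVTendsto (fun i => dyadicMean (H.kernel (y i)) (H.kernel (y i) o) n) l
      (dyadicMean (H.kernel y₀) (H.kernel y₀ o) n) :=
  H.tvTendsto_dyadicMean hy
    (H.tvTendsto_kernel hp hπ tendsto_const_nhds hy (((H.cont o).tendsto _).comp hy)) n

end Continuity

end MinimalFamily

/-! ### Topological amenability -/

theorem TVTendsto.tendsto_integral {ι Y : Type*} [MeasurableSpace Y] {ν : ι → Measure Y}
    {l : Filter ι} {ν₀ : Measure Y} (h : TVTendsto ν l ν₀) {f : Y → ℝ} (hf : Measurable f)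
    {C : ℝ} (hC : ∀ y, |f y| ≤ C) :
    Tendsto (fun i => ∫ y, f y ∂(ν i)) l (𝓝 (∫ y, f y ∂ν₀)) := by
  have hB : 0 < max C 1 := lt_max_of_lt_right one_pos
  have hu : UnitFun fun y => f y / max C 1 := by
    refine ⟨hf.div_const _, fun y => ?_⟩
    rw [abs_div, abs_of_pos hB]
    exact div_le_one_of_le₀ ((hC y).trans (le_max_left _ _)) hB.le
  rw [Metric.tendsto_nhds]
  intro ε hε
  filter_upwards [h (ε / 2 / max C 1) (by positivity)] with i hi
  have h1 := hi _ hu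
  rw [integral_div, integral_div, ← sub_div, abs_div, abs_of_pos hB,
    div_le_div_iff_of_pos_right hB] at h1
  rw [Real.dist_eq]
  linarith

theorem TVTendsto.comp_kernel {ι Y Z : Type*} [MeasurableSpace Y] [MeasurableSpace Z]
    {ν : ι → Measure Y} [∀ i, IsProbabilityMeasure (ν i)] {l : Filter ι} {ν₀ : Measure Y}
    [IsProbabilityMeasure ν₀] (h : TVTendsto ν l ν₀) (T : Kernel Y Z) [IsMarkovKernel T] :
    TVTendsto (fun i => T ∘ₘ ν i) l (T ∘ₘ ν₀) := by
  intro ε hε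
  filter_upwards [h ε hε] with i hi f hf
  rw [integral_comp_measure _ _ (hf.integrable _), integral_comp_measure _ _ (hf.integrable _)]
  exact hi _ (hf.kernel_integral T)

theorem map_comp_measure {Y Y' Z Z' : Type*} [MeasurableSpace Y] [MeasurableSpace Y']
    [MeasurableSpace Z] [MeasurableSpace Z'] {κ : Kernel Y Z} {κ' : Kernel Y' Z'} {u : Y → Y'}
    {v : Z → Z'} (hu : Measurable u) (hv : Measurable v) (h : ∀ y, κ' (u y) = (κ y).map v)
    (μ : Measure Y) : (κ ∘ₘ μ).map v = κ' ∘ₘ (μ.map u) := by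
  ext B hB
  rw [Measure.map_apply hv hB, Measure.bind_apply (hv hB) κ.aemeasurable,
    Measure.bind_apply hB κ'.aemeasurable, lintegral_map (κ'.measurable_coe hB) hu]
  refine lintegral_congr fun y => ?_
  rw [h, Measure.map_apply hv hB]

theorem map_dyadicMean {S : Type*} [MeasurableSpace S] {κ κ' : Kernel S S} [IsMarkovKernel κ]
    [IsMarkovKernel κ'] {u : S → S} (hu : Measurable u) (h : ∀ s, κ' (u s) = (κ s).map u)
    (α : Measure S) (n : ℕ) : (dyadicMean κ α n).map u = dyadicMean κ' (α.map u) n := by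
  have hiter : ∀ i, (iterMeasure κ α i).map u = iterMeasure κ' (α.map u) i := by
    intro i
    induction i with
    | zero => rfl
    | succ i ih => rw [iterMeasure, iterMeasure, map_comp_measure hu hu h, ih]
  ext B hB
  rw [Measure.map_apply hu hB, dyadicMean, dyadicMean, Measure.smul_apply, Measure.smul_apply,
    Measure.finsetSum_apply, Measure.finsetSum_apply]
  simp_rw [← hiter, Measure.map_apply hu hB]

theorem MinimalFamily.topologicallyAmenable {G S X : Type*} [Group G] [TopologicalSpace G]
    [IsTopologicalGroup G] [LocallyCompactSpace G] [SecondCountableTopology G]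
    [MeasurableSpace G] [BorelSpace G]
    [TopologicalSpace S] [LocallyCompactSpace S] [T2Space S] [SecondCountableTopology S]
    [MeasurableSpace S] [BorelSpace S] [MulAction G S] [ContinuousSMul G S]
    [ProperSMul G S] [TopologicalSpace X] [FirstCountableTopology X] [MulAction G X]
    [ContinuousSMul G X] {m : Measure S} {π : Kernel S S} [IsMarkovKernel π]
    (hinv : IsInvariantOperator G π) (hdens : HasContinuousDensities π m) {o : S}
    {φ : X → S → ℝ} (H : MinimalFamily G π o φ) : TopologicallyAmenable G X := by
  obtain ⟨p, hp, hπ⟩ := hdens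
  obtain ⟨T, hT, hTinv⟩ := exists_equivariant_markovKernel G S
  have : Nonempty S := ⟨o⟩
  obtain ⟨μ, hμ, hac⟩ := exists_dominating_measure hp hπ
  have hmeas : ∀ g : G, Measurable fun s : S => g • s := fun g =>
    (continuous_const_smul g).measurable
  -- The chain starts from `H.kernel x o` rather than from the point mass at `o`: when the starting
  -- point moves, these laws vary continuously in total variation, whereas point masses need not.
  let θ : ℕ → X → ProbabilityMeasure G := fun n x =>
    ⟨T ∘ₘ dyadicMean (H.kernel x) (H.kernel x o) n, inferInstance⟩
  refine ⟨θ, fun n => continuous_iff_continuousAt.2 fun x => ?_, fun K hK => ?_⟩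
  · refine ProbabilityMeasure.tendsto_iff_forall_integral_tendsto.2 fun f => ?_
    exact ((H.tvTendsto_dyadicMean_base hp hπ tendsto_id n).comp_kernel T).tendsto_integral f.continuous.measurable
      f.norm_coe_le_norm
  rw [← tendstoLocallyUniformlyOn_iff_tendstoUniformlyOn_of_compact hK]
  refine TendstoLocallyUniformly.tendstoLocallyUniformlyOn ?_
  rw [Metric.tendstoLocallyUniformly_iff]
  rintro ε hε ⟨g₀, x₀⟩
  -- Merging is used only at the centre `(g₀, x₀)`. The bound `ε / 4`, with two continuity errors `ε
  -- / 8`, gives `ε / 2` at this `n` on a neighbourhood that does not depend on the later index `k`.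
  obtain ⟨n, hn⟩ := exists_integral_dyadicMean_sub_le (H.kernel (g₀ • x₀)) μ
    (fun s => (doob_absolutelyContinuous (H.measurable _) s).trans (hac s))
    (fun h hh hharm => (H.minimal (g₀ • x₀)).eq_of_doob_harmonic hh hharm) (g₀ • o) o
    (show 0 < ε / 4 by positivity)
  have hfst : Tendsto (fun z : G × X => z.1) (𝓝 (g₀, x₀)) (𝓝 g₀) := continuous_fst.tendsto _
  have hsnd : Tendsto (fun z : G × X => z.2) (𝓝 (g₀, x₀)) (𝓝 x₀) := continuous_snd.tendsto _
  have hact : Tendsto (fun z : G × X => z.1 • z.2) (𝓝 (g₀, x₀)) (𝓝 (g₀ • x₀)) :=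
    hfst.smul hsnd
  have h1 := H.tvTendsto_dyadicMean hact (H.tvTendsto_kernel hp hπ (hfst.smul_const o) hact
    (H.tendsto_smul_base hp hπ hfst hsnd)) n (ε / 8) (by positivity)
  have h2 := H.tvTendsto_dyadicMean_base hp hπ hact n (ε / 8) (by positivity)
  refine ⟨_, h1.and h2, eventually_atTop.2 ⟨n, fun k hk => ?_⟩⟩
  rintro ⟨g, x⟩ ⟨h3, h4⟩
  rw [dist_comm, Real.dist_eq, sub_zero]
  change |tvNorm ((θ k x : Measure G).map (fun h => g * h)) (θ k (g • x) : Measure G)| < ε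
  rw [abs_of_nonneg (tvNorm_nonneg _ _)]
  refine (tvNorm_le _ _ (C := ε / 2) fun f hf => ?_).trans_lt (half_lt_self hε)
  have h5 := integral_dyadicMean_sub_le_of_le (H.kernel (g • x)) (H.kernel (g • x) (g • o))
    (β := H.kernel (g • x) o) hk (ε := ε / 2) (fun f hf => by
      have e1 := le_of_abs_le (h3 f hf)
      have e2 := neg_le_of_abs_le (h4 f hf)
      have e3 := hn f hf
      simp only at e1 e2
      linarith)
  -- Equivariance of `T` and of the Doob kernels turns translation by `g` into a change of starting
  -- point from `o` to `g • o` for the chain at `g • x`.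
  have hmap : (T ∘ₘ dyadicMean (H.kernel x) (H.kernel x o) k).map (fun h => g * h) =
      T ∘ₘ dyadicMean (H.kernel (g • x)) (H.kernel (g • x) (g • o)) k := by
    rw [map_comp_measure (hmeas g) (measurable_const_mul g) (hTinv g),
      map_dyadicMean (hmeas g) (H.kernel_smul hinv g x), H.kernel_smul hinv g x o]
  change ∫ y, f y ∂((T ∘ₘ dyadicMean (H.kernel x) (H.kernel x o) k).map (fun h => g * h)) -
    ∫ y, f y ∂(T ∘ₘ dyadicMean (H.kernel (g • x)) (H.kernel (g • x) o) k) ≤ ε / 2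
  rw [hmap, integral_comp_measure _ _ (hf.integrable _),
    integral_comp_measure _ _ (hf.integrable _)]
  exact h5 _ (hf.kernel_integral T)

/-! ### From projective classes to normalized functions -/

theorem IsMinimalPositiveHarmonic.div_const {S : Type*} [MeasurableSpace S] {π : Kernel S S}
    {f : S → ℝ} (hf : IsMinimalPositiveHarmonic π f) {c : ℝ} (hc : 0 < c) :
    IsMinimalPositiveHarmonic π (fun s => f s / c) := by
  obtain ⟨⟨hm, hi⟩, hpos, hmin⟩ := hf
  refine ⟨⟨hm.div_const c, fun s => ⟨(hi s).1.div_const c, by rw [integral_div, (hi s).2]⟩⟩,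
    fun s => div_pos (hpos s) hc, fun h ⟨hhm, hhi⟩ h0 hle => ?_⟩
  obtain ⟨d, hd⟩ := hmin (fun s => c * h s)
    ⟨hhm.const_mul c, fun s => ⟨(hhi s).1.const_mul c, by rw [integral_const_mul, (hhi s).2]⟩⟩
    (fun s => mul_nonneg hc.le (h0 s)) (fun s => (le_div_iff₀' hc).1 (hle s))
  refine ⟨d, fun s => ?_⟩
  rw [← mul_div_assoc, eq_div_iff hc.ne', mul_comm, hd]

/-- The ratio of two values of a positive function depends only on its projective class. -/
def ProjClass.ratio {S : Type*} (s t : S) : ProjClass S → ℝ :=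
  Quotient.lift (fun f => f.1 s / f.1 t) (by
    rintro f h ⟨c, hc, e⟩
    simp only [e]
    rw [mul_div_mul_left _ _ hc.ne'])

theorem ProjClass.continuous_ratio {S : Type*} (s t : S) :
    Continuous (ProjClass.ratio s t) :=
  Continuous.quotient_lift (((continuous_apply s).comp continuous_subtype_val).div
    ((continuous_apply t).comp continuous_subtype_val) fun f => (f.2 t).ne') _

/-- Normalizing the projective classes at a base point gives a family of minimal functions. -/
theorem exists_minimalFamily {G S X : Type*} [Group G] [MulAction G S] [MulAction G X]
    [TopologicalSpace X] [MeasurableSpace S] {π : Kernel S S} {Φ : X → ProjClass S}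
    (hcont : Continuous Φ) (hequiv : ∀ (g : G) (x : X), Φ (g • x) = ProjClass.translate g (Φ x))
    (hmin : ∀ x : X, ProjClass.IsMinimalHarmonic π (Φ x)) (o : S) :
    ∃ φ : X → S → ℝ, MinimalFamily G π o φ := by
  choose f hf hfΦ using hmin
  have hratio : ∀ x s, (f x).1 s / (f x).1 o = ProjClass.ratio s o (Φ x) := fun x s => by
    rw [← hfΦ x]
    rfl
  refine ⟨fun x s => (f x).1 s / (f x).1 o, fun x => (hf x).div_const ((f x).2 o), fun s => ?_,
    fun x => div_self ((f x).2 o).ne', fun g x s => ?_⟩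
  · simp_rw [hratio]
    exact (ProjClass.continuous_ratio s o).comp hcont
  · have h1 := hequiv g x
    rw [← hfΦ, ← hfΦ] at h1
    obtain ⟨c, hc, e⟩ := Quotient.exact h1
    have e1 : (f x).1 s = c * (f (g • x)).1 (g • s) := by
      rw [← e (g • s)]
      exact congrArg (f x).1 (inv_smul_smul g s).symm
    have e2 : (f x).1 (g⁻¹ • o) = c * (f (g • x)).1 o := e o
    have h2 := (f x).2 o
    have h3 := (f (g • x)).2 o
    rw [e1, e2]
    field_simp

end MarkovAmenability

end

theorem mainTheorem4
    {G S X : Type*}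
    -- `G` is a locally compact group
    [Group G] [TopologicalSpace G] [IsTopologicalGroup G]
    [LocallyCompactSpace G] [T2Space G] [SecondCountableTopology G]
    [MeasurableSpace G] [BorelSpace G]
    -- acting continuously and properly on a non-empty locally compact space `S`
    [TopologicalSpace S] [LocallyCompactSpace S] [T2Space S] [SecondCountableTopology S]
    [MeasurableSpace S] [BorelSpace S] [Nonempty S]
    [MulAction G S] [ContinuousSMul G S] [ProperSMul G S]
    -- and continuously on a locally compact space `X`
    [TopologicalSpace X] [LocallyCompactSpace X] [T2Space X] [SecondCountableTopology X]
    [MulAction G X] [ContinuousSMul G X]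
    -- a `G`-invariant Borel measure on `S`
    (m : MeasureTheory.Measure S) [MeasureTheory.SMulInvariantMeasure G S m]
    -- a `G`-invariant Markov operator with continuous densities
    (π : ProbabilityTheory.Kernel S S) [ProbabilityTheory.IsMarkovKernel π]
    (hinv : MarkovAmenability.IsInvariantOperator G π)
    (hdens : MarkovAmenability.HasContinuousDensities π m)
    -- a continuous equivariant map to projective classes of minimal positive harmonic functions
    (Φ : X → MarkovAmenability.ProjClass S)
    (hcont : Continuous Φ)
    (hequiv : ∀ (g : G) (x : X), Φ (g • x) = MarkovAmenability.ProjClass.translate g (Φ x))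
    (hmin : ∀ x : X, MarkovAmenability.ProjClass.IsMinimalHarmonic π (Φ x)) :
    MarkovAmenability.TopologicallyAmenable G X := by
  obtain ⟨φ, H⟩ := MarkovAmenability.exists_minimalFamily (G := G) hcont hequiv hmin
    (Classical.arbitrary S)
  exact H.topologicallyAmenable hinv hdens
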